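/- A hypergraph $D=(X,\mathcal B)$ consists of a finite set $X$ of points and a finite multiset $\mathcal B$ of subsets of $X$, called blocks (all counts of blocks are with multiplicity); it is $k$-uniform if every block has exactly $k$ points. It is a covering design if any two points, not necessarily distinct, lie together in at least one block, and a linear space if moreover any two distinct points lie together in exactly one block. A projective plane of order $s\ge 1$ is an $(s+1)$-uniform linear space with $s^2+s+1$ points and $s^2+s+1$ blocks. An affine plane of order $s\ge 2$ is an $s$-uniform linear space with $s^2$ points and $s^2+s$ blocks. An almost projective plane of order $s$ is an $(s+1)$-uniform covering design with $s^2+s$ points and $s^2+s$ blocks in which each point is in exactly $s+1$ blocks. For a covering design $D=(X,\mathcal B)$ with $X\ne\emptyset$, let $$L(D)=\inf_w \max_{B\in\mathcal B}\sum_{x\in B}w(x),$$ where the infimum is over all $w:X\to[0,\infty)$ with $\sum_{x\in X}w(x)=1$. For a positive integer $m$, let $L(m)$ be the infimum of $L(D)$ over all covering designs $D$ with a nonempty point set and exactly $m$ blocks. **Theorem.** (a) For each positive integer $s$, we have $L(s^2+s+1)=\frac{s+1}{s^2+s+1}$ if and only if a projective plane of order $s$ exists. Furthermore, if $D$ is a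 covering design with $s^2+s+1$ blocks and at most $s^2+s+1$ points such that $L(D)=\frac{s+1}{s^2+s+1}$, then $D$ is a projective plane of order $s$. (b) For each integer $s\ge 2$, we have $L(s^2+s)=\frac1s$ if and only if an affine plane of order $s$ exists or an almost projective plane of order $s$ exists. Furthermore, if $D$ is a covering design with $s^2+s$ blocks and at most $s^2$ points such that $L(D)=\frac1s$, then $D$ is an affine plane of order $s$. -/

import Mathlib

noncomputable section

namespace ATAC

/-- A hypergraph on the point set `X` (finite, by a `Fintype` instance wherever it is used):
a finite multiset of subsets of `X`, called edges or blocks. (Mathlib's `Hypergraph` has a set of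
edges, so that it does not allow repeated blocks.) -/
structure MultiHypergraph (X : Type*) where
  blocks : Multiset (Finset X)

namespace MultiHypergraph

variable {X : Type*}

/-- Every block has exactly `k` points. -/
def IsUniform (D : MultiHypergraph X) (k : ℕ) : Prop :=
  ∀ B ∈ D.blocks, B.card = k

/-- Any two points occur together in at least one block. The case `x = y`, which says that every
point lies in a block, is implied by the others unless `X` has exactly one point. -/
def IsCoveringDesign (D : MultiHypergraph X) : Prop :=
  ∀ x y : X, ∃ B ∈ D.blocks, x ∈ B ∧ y ∈ B

open Classical in
/-- The number of blocks, counted with multiplicity, that contain `x`. -/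
def degree (D : MultiHypergraph X) (x : X) : ℕ :=
  D.blocks.countP (fun B => x ∈ B)

open Classical in
/-- The number of blocks, counted with multiplicity, that contain both `x` and `y`. -/
def pairDegree (D : MultiHypergraph X) (x y : X) : ℕ :=
  D.blocks.countP (fun B => x ∈ B ∧ y ∈ B)

/-- A covering design in which any two distinct points occur together in exactly one block. -/
def IsLinearSpace (D : MultiHypergraph X) : Prop :=
  D.IsCoveringDesign ∧ ∀ x y : X, x ≠ y → D.pairDegree x y = 1

/-- Projective plane of order `s` (meant for `1 ≤ s`). -/
def IsProjectivePlane [Fintype X] (D : MultiHypergraph X) (s : ℕ) : Prop :=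
  D.IsLinearSpace ∧ D.IsUniform (s + 1) ∧
    Fintype.card X = s ^ 2 + s + 1 ∧ D.blocks.card = s ^ 2 + s + 1

/-- Affine plane of order `s` (meant for `2 ≤ s`). -/
def IsAffinePlane [Fintype X] (D : MultiHypergraph X) (s : ℕ) : Prop :=
  D.IsLinearSpace ∧ D.IsUniform s ∧
    Fintype.card X = s ^ 2 ∧ D.blocks.card = s ^ 2 + s

/-- Almost projective plane of order `s`. -/
def IsAlmostProjectivePlane [Fintype X] (D : MultiHypergraph X) (s : ℕ) : Prop :=
  D.IsCoveringDesign ∧ D.IsUniform (s + 1) ∧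
    Fintype.card X = s ^ 2 + s ∧ D.blocks.card = s ^ 2 + s ∧ ∀ x : X, D.degree x = s + 1

/-- A normalised weighting of `X`: nonnegative real weights of total `1`. -/
def IsNormalisedWeighting [Fintype X] (w : X → ℝ) : Prop :=
  (∀ x, 0 ≤ w x) ∧ ∑ x, w x = 1

/-- `L(D, w)`, the maximum weight of a block. (The set is finite, and it is nonempty whenever `D` is
a covering design with at least one point.) -/
def maxWeight (D : MultiHypergraph X) (w : X → ℝ) : ℝ :=
  sSup {r : ℝ | ∃ B ∈ D.blocks, r = ∑ x ∈ B, w x}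

/-- `L(D)`, the infimum of `L(D, w)` over all normalised weightings `w`. -/
def limit [Fintype X] (D : MultiHypergraph X) : ℝ :=
  sInf {r : ℝ | ∃ w : X → ℝ, IsNormalisedWeighting w ∧ r = D.maxWeight w}

end MultiHypergraph

/-- `L(m)`, the infimum of `L(D)` over all covering designs `D` with `m` blocks. The point set is
required to be nonempty, since the empty set has no normalised weighting. -/
def dataLimit (m : ℕ) : ℝ :=
  sInf {r : ℝ | ∃ (X : Type) (_ : Fintype X) (_ : Nonempty X) (D : MultiHypergraph X),
    D.IsCoveringDesign ∧ D.blocks.card = m ∧ r = D.limit}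

end ATAC

end

/-! Record each point `x` by the set `S x` of blocks through it. If a support point has degree `d`,
its blocks cover the total weight once and the point itself `d` times, so `1 + (d - 1) * w x ≤ d *
v` (`one_add_le`). Hence either `v ≥ 1 / s`, or all support degrees are at least `s + 1` and
averaging over the `m` blocks gives `v ≥ (s + 1) / m` (`value_ge`). At the two values of the
theorem, equality forces support degrees `s + 1` and equal loads (`tight`). The first inequality
then says `w x ≤ 1 / q`, with `q = s ^ 2 + s + 1` in (a) and `q = s ^ 2` in (b); on at most `q`
points the weights are uniform and the design is a plane (`flat`). Conversely, uniform weights on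
the designs named give the upper bounds (`dataLimit_le`).

For existence, the optimum is attained by compactness (`exists_isFeasible_dataLimit`), and an
optimal weighting of minimal support has independent incidence rows (`exists_linearIndependent`), so
there are at most as many points as blocks. This settles (a). In (b) there may be more than `s ^ 2`
points. A point joined exactly once to every other would then lie on so many blocks of size `s` that
their parallel classes give too many independent vectors orthogonal to the rows
(`exists_card_inter_ne_one`). So every point has a repeated join, and counting these against block
sizes leaves only the almost projective plane (`card_block_of_lt`). -/

namespace ATAC

open Finset

variable {X ι : Type*} [Fintype X] [DecidableEq ι]

/-! ### Designs as set systems, and double counting -/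

/-- The points `x` with `i ∈ S x`, where `S x` is the set of (indices of) blocks through `x`. -/
def block (S : X → Finset ι) (i : ι) : Finset X := {x | i ∈ S x}

/-- The total weight of the block with index `i`. -/
def load (S : X → Finset ι) (w : X → ℝ) (i : ι) : ℝ := ∑ x ∈ block S i, w x

/-- The hypergraph whose blocks through `x` are those with index in `S x`. -/
def ofSystem [Fintype ι] (S : X → Finset ι) : MultiHypergraph X := ⟨univ.val.map (block S)⟩

@[simp]
lemma mem_block {S : X → Finset ι} {i : ι} {x : X} : x ∈ block S i ↔ i ∈ S x := by
  simp [block]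

lemma mem_blocks_ofSystem [Fintype ι] {S : X → Finset ι} {B : Finset X} :
    B ∈ (ofSystem S).blocks ↔ ∃ i, block S i = B := by
  simp [ofSystem]

lemma card_blocks_ofSystem [Fintype ι] (S : X → Finset ι) :
    (ofSystem S).blocks.card = Fintype.card ι := by
  simp [ofSystem]

lemma isCoveringDesign_ofSystem [Fintype ι] {S : X → Finset ι} :
    (ofSystem S).IsCoveringDesign ↔ ∀ x y, (S x ∩ S y).Nonempty := by
  refine forall₂_congr fun x y => ?_
  simp [mem_blocks_ofSystem, Finset.Nonempty]

lemma isUniform_ofSystem [Fintype ι] {S : X → Finset ι} {k : ℕ} :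
    (ofSystem S).IsUniform k ↔ ∀ i, (block S i).card = k := by
  simp [MultiHypergraph.IsUniform, mem_blocks_ofSystem]

lemma degree_ofSystem [Fintype ι] (S : X → Finset ι) (x : X) :
    (ofSystem S).degree x = (S x).card := by
  classical
  simp only [MultiHypergraph.degree, ofSystem, Multiset.countP_map, mem_block]
  rw [← Finset.filter_val, Finset.card_val]
  congr 1
  ext i
  simp

lemma pairDegree_ofSystem [Fintype ι] (S : X → Finset ι) (x y : X) :
    (ofSystem S).pairDegree x y = (S x ∩ S y).card := by
  classical
  simp only [MultiHypergraph.pairDegree, ofSystem, Multiset.countP_map, mem_block]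
  rw [← Finset.filter_val, Finset.card_val]
  congr 1
  ext i
  simp

/-- Numbering the blocks keeps repeated blocks apart, so that multiplicities become cardinalities of
index sets. -/
lemma exists_eq_ofSystem (D : MultiHypergraph X) {m : ℕ} (h : D.blocks.card = m) :
    ∃ S : X → Finset (Fin m), D = ofSystem S := by
  classical
  obtain ⟨l⟩ := D
  induction l using Quotient.inductionOn with
  | h l =>
    have h' : l.length = m := by simpa using h
    subst h'
    refine ⟨fun x => {i | x ∈ l[i]}, ?_⟩
    have hb : block (fun x => ({i | x ∈ l[i]} : Finset (Fin l.length))) = fun i => l[i] := by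
      ext i x
      simp
    simp only [ofSystem, hb]
    congr 1
    have : (univ : Finset (Fin l.length)).val = (List.finRange l.length : Multiset _) := rfl
    rw [this, Multiset.map_coe]
    simp

/-- Double counting of the incidences between points and the blocks with index in `T`. -/
lemma sum_load (S : X → Finset ι) (w : X → ℝ) (T : Finset ι) :
    ∑ i ∈ T, load S w i = ∑ x, w x * ((T ∩ S x).card : ℝ) := by
  simp only [load, block, Finset.sum_filter]
  rw [Finset.sum_comm]
  refine Finset.sum_congr rfl fun x _ => ?_
  rw [← Finset.sum_filter, Finset.sum_const, nsmul_eq_mul, mul_comm, Finset.filter_mem_eq_inter]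

lemma sum_card_block (S : X → Finset ι) (T : Finset ι) :
    ∑ i ∈ T, ((block S i).card : ℝ) = ∑ x, ((T ∩ S x).card : ℝ) := by
  simpa [load] using sum_load S (fun _ => 1) T

lemma sum_load_univ [Fintype ι] (S : X → Finset ι) (w : X → ℝ) :
    ∑ i, load S w i = ∑ x, w x * ((S x).card : ℝ) := by
  simpa using sum_load S w univ

lemma maxWeight_ofSystem [Fintype ι] [Nonempty ι] (S : X → Finset ι) (w : X → ℝ) :
    (ofSystem S).maxWeight w = univ.sup' univ_nonempty (load S w) := by
  rw [MultiHypergraph.maxWeight, Finset.sup'_eq_csSup_image]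
  congr 1
  ext r
  simp [mem_blocks_ofSystem, load, eq_comm]

lemma maxWeight_ofSystem_le_iff [Fintype ι] [Nonempty ι] {S : X → Finset ι} {w : X → ℝ} {v : ℝ} :
    (ofSystem S).maxWeight w ≤ v ↔ ∀ i, load S w i ≤ v := by
  simp [maxWeight_ofSystem]

lemma continuous_maxWeight_ofSystem [Fintype ι] [Nonempty ι] (S : X → Finset ι) :
    Continuous fun w : X → ℝ => (ofSystem S).maxWeight w := by
  simp only [maxWeight_ofSystem]
  refine Continuous.finset_sup'_apply _ fun i _ => ?_
  exact continuous_finsetSum _ fun x _ => continuous_apply x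

/-! ### Feasible weightings and the averaging bound -/

/-- `w` is a normalised weighting, any two points of its support lie in a common block, and no
block has weight more than `v`. -/
structure IsFeasible (S : X → Finset ι) (w : X → ℝ) (v : ℝ) : Prop where
  nonneg : ∀ x, 0 ≤ w x
  sum_eq_one : ∑ x, w x = 1
  inter : ∀ x y, w x ≠ 0 → w y ≠ 0 → (S x ∩ S y).Nonempty
  load_le : ∀ i, load S w i ≤ v

namespace IsFeasible

variable {S : X → Finset ι} {w : X → ℝ} {v : ℝ}

/-- The blocks through `x` contain every support point at least once and `x` itself `(S x).card`
times; sum their loads. -/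
lemma one_add_le (h : IsFeasible S w v) {x : X} (hx : w x ≠ 0) :
    1 + ((S x).card - 1) * w x ≤ (S x).card * v := by
  classical
  have h1 : ∑ i ∈ S x, load S w i ≤ (S x).card * v := by
    simpa using Finset.sum_le_sum fun i (_ : i ∈ S x) => h.load_le i
  have h2 : ∑ y, (w y + if y = x then ((S x).card - 1) * w x else 0) ≤
      ∑ y, w y * ((S x ∩ S y).card : ℝ) := by
    refine Finset.sum_le_sum fun y _ => ?_
    split_ifs with hy
    · subst hy
      simp only [inter_self]
      linarith
    · by_cases hwy : w y = 0
      · simp [hwy]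
      · have : (1 : ℝ) ≤ ((S x ∩ S y).card : ℝ) := by
          exact_mod_cast (h.inter x y hx hwy).card_pos
        nlinarith [h.nonneg y]
  rw [sum_load] at h1
  rw [Finset.sum_add_distrib, h.sum_eq_one, Finset.sum_ite_eq' univ x] at h2
  simpa using h2.trans h1

lemma card_pos (h : IsFeasible S w v) {x : X} (hx : w x ≠ 0) : 1 ≤ (S x).card := by
  have := h.inter x x hx hx
  rw [inter_self] at this
  exact this.card_pos

lemma value_nonneg (h : IsFeasible S w v) [Nonempty ι] : 0 ≤ v :=
  (Finset.sum_nonneg fun x _ => h.nonneg x).trans (h.load_le (Classical.arbitrary ι))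

/-- Either some point is on few blocks, and these have total weight at least `1`, or the average
weight of a block is large. -/
lemma value_ge [Fintype ι] [Nonempty ι] (h : IsFeasible S w v) (s : ℕ) :
    1 ≤ s * v ∨ (s + 1 : ℝ) ≤ Fintype.card ι * v := by
  by_cases hd : ∀ x, w x ≠ 0 → s + 1 ≤ (S x).card
  · right
    have h1 : ∑ i, load S w i ≤ Fintype.card ι * v := by
      simpa using Finset.sum_le_sum fun i (_ : i ∈ univ) => h.load_le i
    rw [sum_load_univ] at h1
    refine le_trans ?_ h1
    calc (s + 1 : ℝ) = ∑ x, w x * (s + 1) := by rw [← Finset.sum_mul, h.sum_eq_one, one_mul]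
      _ ≤ _ := Finset.sum_le_sum fun x _ => ?_
    by_cases hx : w x = 0
    · simp [hx]
    · exact mul_le_mul_of_nonneg_left (by exact_mod_cast hd x hx) (h.nonneg x)
  · left
    push Not at hd
    obtain ⟨x, hx, hlt⟩ := hd
    have h1 := h.one_add_le hx
    have h2 : (1 : ℝ) ≤ (S x).card := by exact_mod_cast h.card_pos hx
    have h3 : ((S x).card : ℝ) ≤ s := by exact_mod_cast Nat.lt_succ_iff.1 hlt
    nlinarith [h.nonneg x, h.value_nonneg]

/-- If all points of the support are on at least `s + 1` blocks and the average weight of a block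
is as large as possible, then all inequalities in the averaging argument are tight. -/
lemma tight [Fintype ι] (h : IsFeasible S w v) {s : ℕ} (hd : ∀ x, w x ≠ 0 → s + 1 ≤ (S x).card)
    (hv : Fintype.card ι * v = s + 1) :
    (∀ x, w x ≠ 0 → (S x).card = s + 1) ∧ ∀ i, load S w i = v := by
  have h1 : ∀ x ∈ univ, w x * (s + 1 : ℝ) ≤ w x * (S x).card := by
    intro x _
    by_cases hx : w x = 0
    · simp [hx]
    · exact mul_le_mul_of_nonneg_left (by exact_mod_cast hd x hx) (h.nonneg x)
  have h2 : ∀ i ∈ univ, load S w i ≤ v := fun i _ => h.load_le i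
  have e1 : ∑ x, w x * (s + 1 : ℝ) = s + 1 := by rw [← Finset.sum_mul, h.sum_eq_one, one_mul]
  have e2 : ∑ _i : ι, v = s + 1 := by simpa using hv
  have e3 := sum_load_univ S w
  -- The total load is squeezed between `e1` and `e2`, which are both `s + 1`, so both estimates
  -- hold termwise with equality.
  have l1 := Finset.sum_le_sum h1
  have l2 := Finset.sum_le_sum h2
  constructor
  · intro x hx
    have := (Finset.sum_eq_sum_iff_of_le h1).1 (by linarith) x (mem_univ x)
    have := mul_left_cancel₀ hx this
    exact_mod_cast this.symm
  · intro i
    exact (Finset.sum_eq_sum_iff_of_le h2).1 (by linarith) i (mem_univ i)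

end IsFeasible

end ATAC

/-! ### Linear independence and pointwise weight bounds -/

namespace ATAC

open Finset

variable {X ι : Type*} [Fintype X]

lemma sum_support (w f : X → ℝ) [Fintype {x // w x ≠ 0}] (hf : ∀ x, w x = 0 → f x = 0) :
    ∑ x : {x // w x ≠ 0}, f x = ∑ x, f x := by
  classical
  rw [← Finset.sum_filter_of_ne (p := fun x => w x ≠ 0) fun x _ hx h0 => hx (hf x h0)]
  exact (Finset.sum_subtype _ (by simp) f).symm

/-- Vectors annihilated by independent rows. -/
lemma card_add_card_le [Fintype ι] {J : Type*} [Fintype J] {r : X → ι → ℝ} {u : J → ι → ℝ}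
    (hr : LinearIndependent ℝ r) (hu : LinearIndependent ℝ u)
    (h : ∀ x j, ∑ i, r x i * u j i = 0) :
    Fintype.card X + Fintype.card J ≤ Fintype.card ι := by
  have h1 : (Matrix.of r).rank = Fintype.card X := LinearIndependent.rank_matrix hr
  have h2 := LinearMap.finrank_range_add_finrank_ker (Matrix.of r).mulVecLin
  have h3 : ∀ j, u j ∈ LinearMap.ker (Matrix.of r).mulVecLin := by
    intro j
    rw [LinearMap.mem_ker, Matrix.mulVecLin_apply]
    ext x
    exact h x j
  have h4 : LinearIndependent ℝ fun j => (⟨u j, h3 j⟩ : LinearMap.ker (Matrix.of r).mulVecLin) :=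
    LinearIndependent.of_comp (Submodule.subtype _) hu
  have h5 := h4.fintype_card_le_finrank
  rw [Matrix.rank] at h1
  simp only [Module.finrank_fintype_fun_eq_card] at h2
  omega

variable [DecidableEq ι]

/-- The row of the point-block incidence matrix that belongs to `x`. -/
def incidence (S : X → Finset ι) (x : X) (i : ι) : ℝ := if i ∈ S x then 1 else 0

lemma sum_mul_incidence (S : X → Finset ι) (c : X → ℝ) (i : ι) :
    ∑ x, c x * incidence S x i = load S c i := by
  simp [incidence, load, block, Finset.sum_filter]

namespace IsFeasible

variable {S : X → Finset ι} {w : X → ℝ} {v : ℝ}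

/-- The restriction of a feasible weighting to its support. -/
lemma restrict [Fintype {x // w x ≠ 0}] (h : IsFeasible S w v) :
    IsFeasible (fun x : {x // w x ≠ 0} => S x) (fun x => w x) v := by
  refine ⟨fun x => h.nonneg x, ?_, fun x y hx hy => h.inter x y hx hy, fun i => ?_⟩
  · rw [sum_support w w fun x hx => hx, h.sum_eq_one]
  · refine le_trans (le_of_eq ?_) (h.load_le i)
    simp only [load, block, Finset.sum_filter]
    exact sum_support w (fun x => if i ∈ S x then w x else 0) fun x hx => by simp [hx]

/-- A feasible weighting of minimal support has linearly independent incidence rows. -/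
lemma exists_linearIndependent [Fintype ι] (h : IsFeasible S w v) {k : ℕ} (hk : k ≠ 0)
    (hdeg : ∀ w', IsFeasible S w' v → ∀ x, w' x ≠ 0 → (S x).card = k) :
    ∃ w', IsFeasible S w' v ∧
      LinearIndependent ℝ fun x : {x // w' x ≠ 0} => incidence S x.1 := by
  classical
  obtain ⟨u, hu, hmin⟩ := WellFounded.has_min
    (InvImage.wf (fun w' : X → ℝ => ({x | w' x ≠ 0} : Finset X).card) Nat.lt_wfRel.wf)
    {w' | IsFeasible S w' v} ⟨w, h⟩
  have hu : IsFeasible S u v := hu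
  refine ⟨u, hu, ?_⟩
  rw [Fintype.linearIndependent_iff]
  by_contra! hdep
  obtain ⟨g, hg, x₀, hx₀⟩ := hdep
  -- A row dependency, extended by zero off the support, is a direction that leaves every load
  -- unchanged.
  set c : X → ℝ := fun x => if hx : u x ≠ 0 then g ⟨x, hx⟩ else 0 with hc
  have hc0 : ∀ x, u x = 0 → c x = 0 := fun x hx => by simp [hc, hx]
  have hcg : ∀ x : {x // u x ≠ 0}, c x = g x := fun x => by simp [hc, x.2]
  have hload : ∀ i, load S c i = 0 := by
    intro i
    rw [← sum_mul_incidence, ← sum_support u _ fun x hx => by simp [hc0 x hx]]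
    have := congrFun hg i
    simpa [hcg] using this
  -- Constant degree `k` makes the sum of all loads of `c` equal to `k` times its total, so the
  -- total weight is unchanged too.
  have hsum : ∑ x, c x = 0 := by
    have h1 := sum_load_univ S c
    simp only [hload, Finset.sum_const_zero] at h1
    have h2 : ∑ x, c x * ((S x).card : ℝ) = ∑ x, c x * (k : ℝ) := by
      refine Finset.sum_congr rfl fun x _ => ?_
      by_cases hx : u x = 0
      · simp [hc0 x hx]
      · rw [hdeg u hu x hx]
    rw [h2, ← Finset.sum_mul] at h1
    have hk' : (k : ℝ) ≠ 0 := by exact_mod_cast hk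
    exact (mul_eq_zero.1 h1.symm).resolve_right hk'
  obtain ⟨x₁, hx₁⟩ : ∃ x, 0 < c x := by
    by_contra! hle
    have := (Finset.sum_eq_zero_iff_of_nonpos fun x _ => hle x).1 hsum x₀.1 (mem_univ _)
    exact hx₀ (by rw [← hcg, this])
  -- The minimal ratio is the longest step along `-c` that keeps all weights nonnegative; it kills
  -- the weight at `z`.
  obtain ⟨z, hz, hzmin⟩ := Finset.exists_min_image ({x | 0 < c x} : Finset X)
    (fun x => u x / c x) ⟨x₁, by simpa using hx₁⟩
  replace hz : 0 < c z := by simpa using hz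
  have huz : u z ≠ 0 := fun h0 => hz.ne' (hc0 z h0)
  set t := u z / c z with ht
  have ht0 : 0 ≤ t := div_nonneg (hu.nonneg z) hz.le
  have hu' : IsFeasible S (fun x => u x - t * c x) v := by
    have hsupp : ∀ x, u x - t * c x ≠ 0 → u x ≠ 0 := fun x hx h0 => hx (by simp [h0, hc0 x h0])
    refine ⟨fun x => ?_, ?_, fun x y hx hy => hu.inter x y (hsupp x hx) (hsupp y hy), fun i => ?_⟩
    · rcases le_or_gt (c x) 0 with hcx | hcx
      · nlinarith [hu.nonneg x]
      · have := hzmin x (by simpa using hcx)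
        rw [le_div_iff₀ hcx] at this
        linarith
    · rw [Finset.sum_sub_distrib, ← Finset.mul_sum, hsum, hu.sum_eq_one]
      simp
    · have : load S (fun x => u x - t * c x) i = load S u i - t * load S c i := by
        simp only [load]
        rw [Finset.sum_sub_distrib, ← Finset.mul_sum]
      rw [this, hload, mul_zero, sub_zero]
      exact hu.load_le i
  refine hmin _ hu' ?_
  refine Finset.card_lt_card ⟨fun x => ?_, fun hsub => ?_⟩
  · simp only [mem_filter, mem_univ, true_and]
    exact fun hx h0 => hx (by simp [h0, hc0 x h0])
  · have := hsub (x := z) (by simpa using huz)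
    simp only [mem_filter, mem_univ, true_and] at this
    exact this (by rw [ht, div_mul_cancel₀ _ hz.ne', sub_self])

/-- The weight of a point is at most `1 / q` when the weights of the blocks through it add up to
`1 + s / q`. -/
lemma weight_le (h : IsFeasible S w v) {s : ℕ} {q : ℝ} (hs : 1 ≤ s) (hq : 0 < q)
    (hv : (s + 1) * v = 1 + s / q) (hdeg : ∀ x, w x ≠ 0 → (S x).card = s + 1) (x : X) :
    w x ≤ 1 / q := by
  by_cases hx : w x = 0
  · rw [hx]; positivity
  have h1 := h.one_add_le hx
  rw [hdeg x hx] at h1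
  push_cast at h1
  rw [hv] at h1
  have hs' : (0 : ℝ) < s := by exact_mod_cast hs
  have h2 : (s : ℝ) * w x ≤ s * (1 / q) := by
    rw [mul_one_div]; linarith
  exact le_of_mul_le_mul_left h2 hs'

/-- A point of maximal weight is joined to every other point exactly once. -/
lemma card_inter_eq_one (h : IsFeasible S w v) {s : ℕ} {q : ℝ}
    (hv : (s + 1) * v = 1 + s / q) (hdeg : ∀ x, w x ≠ 0 → (S x).card = s + 1)
    (hload : ∀ i, load S w i = v) {x y : X} (hx : w x ≠ 0) (hxq : w x = 1 / q) (hy : w y ≠ 0)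
    (hxy : y ≠ x) : (S x ∩ S y).card = 1 := by
  classical
  have h1 := sum_load S w (S x)
  simp only [hload, Finset.sum_const, hdeg x hx, nsmul_eq_mul] at h1
  push_cast at h1
  have h2 : ∀ y ∈ univ, (w y + if y = x then (s : ℝ) * w x else 0) ≤
      w y * ((S x ∩ S y).card : ℝ) := by
    intro y _
    split_ifs with hy
    · subst hy
      simp only [inter_self, hdeg y hx]
      push_cast
      linarith
    · by_cases hwy : w y = 0
      · simp [hwy]
      · have : (1 : ℝ) ≤ ((S x ∩ S y).card : ℝ) := by
          exact_mod_cast (h.inter x y hx hwy).card_pos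
        nlinarith [h.nonneg y]
  -- With `w x = 1 / q`, the estimate behind `one_add_le` is an equality, hence an equality for each
  -- `y`.
  have h3 := (Finset.sum_eq_sum_iff_of_le h2).1 (by
    rw [Finset.sum_add_distrib, h.sum_eq_one, Finset.sum_ite_eq' univ x, ← h1, hv, hxq]
    simp [div_eq_mul_inv]) y (mem_univ y)
  rw [if_neg hxy, add_zero] at h3
  have := mul_left_cancel₀ hy ((mul_one _).trans h3)
  exact_mod_cast this.symm

/-- If there are at most `q` points, then all inequalities are tight. -/
lemma flat (h : IsFeasible S w v) {s q : ℕ} (hs : 1 ≤ s) (hq : 0 < q)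
    (hv : (s + 1) * v = 1 + s / q) (hdeg : ∀ x, w x ≠ 0 → (S x).card = s + 1)
    (hload : ∀ i, load S w i = v) (hX : Fintype.card X ≤ q) :
    Fintype.card X = q ∧ (∀ x y, x ≠ y → (S x ∩ S y).card = 1) ∧
      ∀ i, ((block S i).card : ℝ) = v * q := by
  have hq' : (0 : ℝ) < q := by exact_mod_cast hq
  have hle := h.weight_le hs hq' hv hdeg
  have hX' : (Fintype.card X : ℝ) ≤ q := by exact_mod_cast hX
  have hsum : ∑ x, w x = ∑ _x : X, 1 / (q : ℝ) := by
    refine le_antisymm (Finset.sum_le_sum fun x _ => hle x) ?_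
    rw [h.sum_eq_one]
    simp only [Finset.sum_const, card_univ, nsmul_eq_mul, mul_one_div]
    exact (div_le_one hq').2 hX'
  have hw : ∀ x, w x = 1 / q := fun x =>
    (Finset.sum_eq_sum_iff_of_le fun x _ => hle x).1 hsum x (mem_univ x)
  have hw0 : ∀ x, w x ≠ 0 := fun x => by rw [hw x]; positivity
  refine ⟨?_, fun x y hxy => h.card_inter_eq_one hv hdeg hload (hw0 x) (hw x) (hw0 y) hxy.symm, ?_⟩
  · have := h.sum_eq_one
    rw [hsum] at this
    simp only [Finset.sum_const, card_univ, nsmul_eq_mul, mul_one_div] at this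
    rw [div_eq_one_iff_eq hq'.ne'] at this
    exact_mod_cast this
  · intro i
    rw [← hload i]
    simp only [load, hw, Finset.sum_const, nsmul_eq_mul]
    field_simp

end IsFeasible

end ATAC

/-! ### Parallel classes and the case of more than `s ^ 2` points -/

namespace ATAC

open Finset

variable {X ι : Type*} [Fintype ι] [DecidableEq ι]

lemma sum_incidence_mul (S : X → Finset ι) (x : X) (f : ι → ℝ) :
    ∑ i, incidence S x i * f i = ∑ i ∈ S x, f i := by
  simp [incidence]

variable [Fintype X]

/-- The blocks parallel to block `i`: itself and the blocks disjoint from it. -/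
def parallelBlocks (S : X → Finset ι) (i : ι) : Finset ι :=
  {j | j = i ∨ ∀ x, i ∈ S x → j ∉ S x}

/-- If the points of block `i` are joined exactly once to every other point, then the blocks
parallel to it partition the points. -/
lemma card_inter_parallel {S : X → Finset ι} {s : ℕ} (hdeg : ∀ x, (S x).card = s + 1) {i : ι}
    (hi : (block S i).card = s)
    (hone : ∀ x ∈ block S i, ∀ y, y ≠ x → (S x ∩ S y).card = 1) (y : X) :
    (S y ∩ parallelBlocks S i).card = 1 := by
  classical
  by_cases hy : i ∈ S y
  · rw [Finset.card_eq_one]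
    refine ⟨i, ?_⟩
    ext j
    simp only [parallelBlocks, mem_inter, mem_filter, mem_univ, true_and, mem_singleton]
    constructor
    · rintro ⟨hj, rfl | hj'⟩
      · rfl
      · exact absurd hj (hj' y hy)
    · rintro rfl
      exact ⟨hy, Or.inl rfl⟩
  · -- every block through `y` meets block `i` in at most one point
    have hle : ∀ j ∈ S y, (block S j ∩ block S i).card ≤ 1 := by
      intro j hj
      rw [Finset.card_le_one]
      intro a ha b hb
      simp only [mem_inter, mem_block] at ha hb
      by_contra hab
      have h1 := hone a (by simpa using ha.2) b (Ne.symm hab)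
      have := Finset.card_le_one.1 h1.le i (by simp [ha.2, hb.2]) j (by simp [ha.1, hb.1])
      exact hy (this ▸ hj)
    have hsum : ∑ j ∈ S y, (block S j ∩ block S i).card = s := by
      have h1 : ∀ j, (block S j ∩ block S i).card = ∑ z ∈ block S i, if j ∈ S z then 1 else 0 := by
        intro j
        rw [Finset.card_eq_sum_ones, Finset.inter_comm, ← Finset.filter_mem_eq_inter,
          Finset.sum_filter]
        simp
      simp only [h1]
      rw [Finset.sum_comm, ← hi, Finset.card_eq_sum_ones]
      refine Finset.sum_congr rfl fun z hz => ?_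
      have hzy : y ≠ z := by
        rintro rfl
        exact hy (by simpa using hz)
      rw [← Finset.sum_filter, Finset.filter_mem_eq_inter, Finset.inter_comm,
        ← Finset.card_eq_sum_ones, hone z hz y hzy]
    have hsplit : ∀ j ∈ S y,
        (block S j ∩ block S i).card + (if j ∈ parallelBlocks S i then 1 else 0) = 1 := by
      intro j hj
      have hji : j ≠ i := fun h => hy (h ▸ hj)
      split_ifs with hp
      · simp only [parallelBlocks, mem_filter, mem_univ, true_and, hji, false_or] at hp
        have : block S j ∩ block S i = ∅ := by
          ext z
          simpa [and_comm] using hp z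
        simp [this]
      · simp only [parallelBlocks, mem_filter, mem_univ, true_and, hji, false_or] at hp
        push Not at hp
        obtain ⟨z, hz1, hz2⟩ := hp
        have : 0 < (block S j ∩ block S i).card :=
          Finset.card_pos.2 ⟨z, by simp [hz1, hz2]⟩
        have := hle j hj
        omega
    -- Of the `s + 1` blocks through `y`, exactly `s` meet block `i`, one for each of its points;
    -- one parallel block is left.
    have h2 := Finset.sum_congr (rfl : S y = S y) hsplit
    rw [Finset.sum_add_distrib, hsum, ← Finset.sum_filter, Finset.filter_mem_eq_inter] at h2
    simp only [Finset.sum_const, hdeg y, smul_eq_mul, mul_one] at h2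
    omega

/-- Independence of the relations between columns that come from pairwise nonparallel blocks. -/
lemma linearIndependent_parallel {S : X → Finset ι} {s : ℕ} {T : Finset ι} (hT : T.card ≤ s)
    (hpar : ∀ i ∈ T, ∀ j ∈ T, j ∈ parallelBlocks S i → j = i) :
    LinearIndependent ℝ fun i : T => fun j =>
      (s + 1 : ℝ) * (if j ∈ parallelBlocks S i then 1 else 0) - 1 := by
  rw [Fintype.linearIndependent_iff]
  intro g hg
  have h1 : ∀ j : T, (s + 1 : ℝ) * g j = ∑ i, g i := by
    intro j
    have := congrFun hg j
    simp only [Finset.sum_apply, Pi.smul_apply, smul_eq_mul, Pi.zero_apply, mul_sub, mul_one,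
      Finset.sum_sub_distrib] at this
    rw [← sub_eq_zero, ← this]
    congr 1
    rw [Finset.sum_eq_single j]
    · simp [parallelBlocks]
      ring
    · intro i _ hij
      rw [if_neg fun h => hij (Subtype.ext (hpar i i.2 j j.2 h)).symm]
      simp
    · simp
  have h2 : (s + 1 : ℝ) * ∑ i, g i = T.card * ∑ i, g i := by
    rw [Finset.mul_sum, Finset.sum_congr rfl fun j _ => h1 j]
    simp
  have hT' : (T.card : ℝ) ≤ s := by exact_mod_cast hT
  have h3 : ∑ i, g i = 0 := by
    have : ((s + 1 : ℝ) - T.card) * ∑ i, g i = 0 := by linarith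
    exact (mul_eq_zero.1 this).resolve_left (by linarith)
  intro j
  have := h1 j
  rw [h3] at this
  exact (mul_eq_zero.1 this).resolve_left (by positivity)

namespace IsFeasible

variable {S : X → Finset ι} {w : X → ℝ} {s : ℕ}

/-- With more than `s ^ 2` points and independent incidence rows, every point is joined more than
once to some other point. -/
lemma exists_card_inter_ne_one (h : IsFeasible S w (1 / s)) (hs : 1 ≤ s)
    (hw : ∀ x, w x ≠ 0) (hι : Fintype.card ι = s ^ 2 + s) (hdeg : ∀ x, (S x).card = s + 1)
    (hload : ∀ i, load S w i = 1 / s) (hind : LinearIndependent ℝ (incidence S))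
    (hX : s ^ 2 < Fintype.card X) (x₀ : X) : ∃ y, y ≠ x₀ ∧ (S x₀ ∩ S y).card ≠ 1 := by
  classical
  by_contra! hx₀
  have hs' : (0 : ℝ) < s := by exact_mod_cast hs
  have hv : ((s : ℝ) + 1) * (1 / s) = 1 + s / (s : ℝ) ^ 2 := by field_simp
  have hle : ∀ x, w x ≤ 1 / (s : ℝ) ^ 2 :=
    h.weight_le hs (by positivity) hv fun x _ => hdeg x
  have hn : Fintype.card X ≤ s ^ 2 + s := by
    rw [← hι]
    simpa using hind.fintype_card_le_finrank
  -- every block has at least `s` points, with equality only if all its points have maximal weight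
  have hk : ∀ i, s ≤ (block S i).card := by
    intro i
    have h1 : load S w i ≤ (block S i).card * (1 / (s : ℝ) ^ 2) := by
      simpa [load] using Finset.sum_le_sum fun x (_ : x ∈ block S i) => hle x
    rw [hload, mul_one_div, div_le_div_iff₀ hs' (by positivity)] at h1
    have : (s : ℝ) ≤ (block S i).card := by nlinarith
    exact_mod_cast this
  have hmax : ∀ i, (block S i).card = s → ∀ x ∈ block S i, w x = 1 / (s : ℝ) ^ 2 := by
    intro i hi
    refine (Finset.sum_eq_sum_iff_of_le fun x _ => hle x).1 ?_
    change load S w i = _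
    rw [hload, Finset.sum_const, hi, nsmul_eq_mul]
    field_simp
  have hpart : ∀ i, (block S i).card = s → ∀ y, (S y ∩ parallelBlocks S i).card = 1 := fun i hi =>
    card_inter_parallel hdeg hi fun x hx y hxy =>
      h.card_inter_eq_one hv (fun x _ => hdeg x) hload (hw x) (hmax i hi x hx) (hw y) hxy
  -- many blocks through `x₀` have exactly `s` points
  have hsmall : s ^ 2 + s + 1 - Fintype.card X ≤ #{i ∈ S x₀ | (block S i).card = s} := by
    have h1 : ∑ i ∈ S x₀, (block S i).card = Fintype.card X + s := by
      have h2 : ∑ i ∈ S x₀, (block S i).card = ∑ y, (S x₀ ∩ S y).card := by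
        exact_mod_cast sum_card_block S (S x₀)
      have h3 : ∀ y ∈ univ, (S x₀ ∩ S y).card = 1 + if y = x₀ then s else 0 := by
        intro y _
        split_ifs with hy
        · rw [hy, inter_self, hdeg, add_comm]
        · rw [hx₀ y hy]
      rw [h2, Finset.sum_congr rfl h3]
      simp [Finset.sum_add_distrib]
    have h4 : (S x₀).card * (s + 1) ≤
        ∑ i ∈ S x₀, ((block S i).card + if (block S i).card = s then 1 else 0) := by
      rw [← smul_eq_mul]
      refine Finset.card_nsmul_le_sum _ _ _ fun i _ => ?_
      have := hk i
      split_ifs <;> omega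
    rw [Finset.sum_add_distrib, h1, ← Finset.sum_filter] at h4
    simp only [Finset.sum_const, hdeg, smul_eq_mul, mul_one] at h4
    have : (s + 1) * (s + 1) = s ^ 2 + s + 1 + s := by ring
    omega
  obtain ⟨T, hTsub, hTcard⟩ := Finset.exists_subset_card_eq hsmall
  have hT : ∀ i ∈ T, i ∈ S x₀ ∧ (block S i).card = s := fun i hi => by
    simpa using hTsub hi
  -- Distinct blocks in `T` share `x₀`, so they are not parallel; `T.card ≤ s` because there are
  -- more than `s ^ 2` points.
  have hlin := linearIndependent_parallel (S := S) (s := s) (T := T) (by omega) (by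
    intro i hi j hj hij
    simp only [parallelBlocks, mem_filter, mem_univ, true_and] at hij
    exact hij.resolve_right fun hd => hd x₀ (hT i hi).1 (hT j hj).1)
  -- Each point has degree `s + 1` and lies on one block of each parallel class, so these vectors
  -- are orthogonal to all rows. Points plus relations number `s ^ 2 + s + 1`, one more than the
  -- blocks.
  have := card_add_card_le hind hlin (by
    intro y i
    rw [sum_incidence_mul, Finset.sum_sub_distrib, ← Finset.mul_sum, ← Finset.sum_filter,
      Finset.filter_mem_eq_inter]
    simp [hpart i (hT i i.2).2 y, hdeg y])
  rw [Fintype.card_coe, hTcard, hι] at this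
  omega

/-- With more than `s ^ 2` points and independent incidence rows, there are as many points as
blocks and all blocks have size `s + 1`. -/
lemma card_block_of_lt (h : IsFeasible S w (1 / s)) (hs : 1 ≤ s)
    (hw : ∀ x, w x ≠ 0) (hι : Fintype.card ι = s ^ 2 + s) (hdeg : ∀ x, (S x).card = s + 1)
    (hload : ∀ i, load S w i = 1 / s) (hind : LinearIndependent ℝ (incidence S))
    (hX : s ^ 2 < Fintype.card X) :
    Fintype.card X = s ^ 2 + s ∧ ∀ i, (block S i).card = s + 1 := by
  classical
  have hs' : (0 : ℝ) < s := by exact_mod_cast hs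
  have hn : Fintype.card X ≤ s ^ 2 + s := by
    rw [← hι]
    simpa using hind.fintype_card_le_finrank
  have hn' : (Fintype.card X : ℝ) ≤ s ^ 2 + s := by exact_mod_cast hn
  set k : ι → ℝ := fun i => (block S i).card with hkdef
  -- Among the pairs at `x`, the `+ s` comes from `x` meeting itself `s + 1` times and the `+ 1`
  -- from a repeated join.
  have hge : ∀ x ∈ univ, w x * (Fintype.card X + s + 1 : ℝ) ≤ w x * ∑ i ∈ S x, k i := by
    intro x _
    refine mul_le_mul_of_nonneg_left ?_ (h.nonneg x)
    obtain ⟨z, hzx, hz⟩ := h.exists_card_inter_ne_one hs hw hι hdeg hload hind hX x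
    rw [hkdef, sum_card_block]
    have h3 : ∀ y ∈ univ, (1 + (if y = x then s else 0) + if y = z then 1 else 0) ≤
        (S x ∩ S y).card := by
      intro y _
      have hpos := (h.inter x y (hw x) (hw y)).card_pos
      by_cases hy : y = x
      · subst hy
        rw [inter_self, hdeg, if_pos rfl, if_neg hzx.symm]
        omega
      · rw [if_neg hy]
        split_ifs with hyz
        · subst hyz
          omega
        · omega
    have h4 := Finset.sum_le_sum h3
    simp only [Finset.sum_add_distrib, Finset.sum_ite_eq', mem_univ, if_true, Finset.sum_const,
      card_univ, smul_eq_mul, mul_one] at h4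
    exact_mod_cast h4
  have hle := Finset.sum_le_sum hge
  have e1 : ∑ x, w x * (Fintype.card X + s + 1 : ℝ) = Fintype.card X + s + 1 := by
    rw [← Finset.sum_mul, h.sum_eq_one, one_mul]
  -- Exchanging the sums turns the left side into block sizes weighted by the constant load `1 / s`.
  have e2 : ∑ x, w x * ∑ i ∈ S x, k i = (Fintype.card X * (s + 1) : ℝ) / s := by
    have hrow : ∀ x, ∑ i ∈ S x, k i = ∑ i, incidence S x i * k i := fun x =>
      (sum_incidence_mul S x k).symm
    simp only [hrow, Finset.mul_sum]
    rw [Finset.sum_comm]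
    have : ∀ i, ∑ x, w x * (incidence S x i * k i) = 1 / s * k i := by
      intro i
      rw [← hload i, ← sum_mul_incidence, Finset.sum_mul]
      exact Finset.sum_congr rfl fun x _ => by ring
    simp only [this]
    rw [← Finset.mul_sum, hkdef, sum_card_block]
    simp [hdeg]
    field_simp
  have hcard : (Fintype.card X : ℝ) = s ^ 2 + s := by
    refine le_antisymm hn' ?_
    rw [e1, e2, le_div_iff₀ hs'] at hle
    nlinarith
  refine ⟨by exact_mod_cast hcard, ?_⟩
  have heq : ∀ x, ∑ i ∈ S x, k i = (s + 1) * (s + 1) := by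
    intro x
    have := (Finset.sum_eq_sum_iff_of_le hge).1 (by
      rw [e1, e2, hcard]
      field_simp
      ring) x (mem_univ x)
    rw [← mul_left_cancel₀ (hw x) this, hcard]
    ring
  -- There are as many independent rows as blocks, so a vector orthogonal to all of them vanishes.
  have hzero : (fun i => k i - (s + 1)) = 0 := by
    by_contra hne
    have := card_add_card_le (J := Unit) (u := fun _ i => k i - (s + 1)) hind
      (LinearIndependent.of_subsingleton (R := ℝ) () hne) (by
        intro x _
        rw [sum_incidence_mul, Finset.sum_sub_distrib, heq]
        simp only [Finset.sum_const, hdeg x, nsmul_eq_mul]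
        push_cast
        ring)
    have h5 : Fintype.card X = s ^ 2 + s := by exact_mod_cast hcard
    simp [hι, h5] at this
  intro i
  have := congrFun hzero i
  simp only [hkdef, Pi.zero_apply, sub_eq_zero] at this
  exact_mod_cast this

end IsFeasible

end ATAC

/-! ### Existence of optimal weightings -/

namespace ATAC

open Finset

section

variable {X ι : Type*} [Fintype X] [Fintype ι] [DecidableEq ι]

lemma isFeasible_maxWeight [Nonempty ι] {S : X → Finset ι}
    (hS : (ofSystem S).IsCoveringDesign) {w : X → ℝ} (hw : MultiHypergraph.IsNormalisedWeighting w) :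
    IsFeasible S w ((ofSystem S).maxWeight w) :=
  ⟨hw.1, hw.2, fun x y _ _ => isCoveringDesign_ofSystem.1 hS x y, maxWeight_ofSystem_le_iff.1 le_rfl⟩

lemma exists_isNormalisedWeighting [Nonempty X] :
    ∃ w : X → ℝ, MultiHypergraph.IsNormalisedWeighting w :=
  ⟨fun _ => 1 / Fintype.card X, fun _ => by positivity, by simp⟩

lemma bddBelow_maxWeight (D : MultiHypergraph X) :
    BddBelow {r : ℝ | ∃ w : X → ℝ, MultiHypergraph.IsNormalisedWeighting w ∧ r = D.maxWeight w} := by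
  refine ⟨0, ?_⟩
  rintro _ ⟨w, hw, rfl⟩
  refine Real.sSup_nonneg ?_
  rintro _ ⟨B, _, rfl⟩
  exact Finset.sum_nonneg fun x _ => hw.1 x

lemma limit_nonneg (D : MultiHypergraph X) : 0 ≤ D.limit := by
  refine Real.sInf_nonneg ?_
  rintro _ ⟨w, hw, rfl⟩
  refine Real.sSup_nonneg ?_
  rintro _ ⟨B, _, rfl⟩
  exact Finset.sum_nonneg fun x _ => hw.1 x

/-- An optimal weighting exists. -/
lemma exists_isFeasible_limit [Nonempty ι] [Nonempty X] {S : X → Finset ι}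
    (hS : (ofSystem S).IsCoveringDesign) : ∃ w, IsFeasible S w (ofSystem S).limit := by
  obtain ⟨w₀, hw₀⟩ := exists_isNormalisedWeighting (X := X)
  obtain ⟨w, hw, hmin⟩ := (isCompact_stdSimplex ℝ X).exists_isMinOn ⟨w₀, hw₀⟩
    (continuous_maxWeight_ofSystem S).continuousOn
  refine ⟨w, ?_⟩
  have : (ofSystem S).limit = (ofSystem S).maxWeight w := by
    refine le_antisymm (csInf_le (bddBelow_maxWeight _) ⟨w, hw, rfl⟩) ?_
    refine le_csInf ⟨_, w₀, hw₀, rfl⟩ ?_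
    rintro _ ⟨w', hw', rfl⟩
    exact hmin hw'
  rw [this]
  exact isFeasible_maxWeight hS hw

/-- Merging the points that lie in the same blocks. -/
lemma IsFeasible.map {S : X → Finset ι} {w : X → ℝ} {v : ℝ} (h : IsFeasible S w v) :
    IsFeasible (id : Finset ι → Finset ι) (fun T => ∑ x with S x = T, w x) v := by
  have hex : ∀ T, ∑ x with S x = T, w x ≠ 0 → ∃ x, S x = T ∧ w x ≠ 0 := by
    intro T hT
    obtain ⟨x, hx, hx'⟩ := Finset.exists_ne_zero_of_sum_ne_zero hT
    exact ⟨x, by simpa using hx, hx'⟩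
  refine ⟨fun T => Finset.sum_nonneg fun x _ => h.nonneg x, ?_, fun T U hT hU => ?_, fun i => ?_⟩
  · rw [Finset.sum_fiberwise, h.sum_eq_one]
  · obtain ⟨x, rfl, hx⟩ := hex T hT
    obtain ⟨y, rfl, hy⟩ := hex U hU
    exact h.inter x y hx hy
  · refine le_trans (le_of_eq ?_) (h.load_le i)
    rw [load, load]
    have := Finset.sum_fiberwise_of_maps_to (s := block S i) (t := block id i) (g := S)
      (fun x hx => by simpa using hx) w
    rw [← this]
    refine Finset.sum_congr rfl fun T hT => Finset.sum_congr ?_ fun _ _ => rfl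
    ext x
    simp only [mem_filter, mem_univ, true_and, mem_block, id] at hT ⊢
    constructor
    · rintro rfl
      exact ⟨hT, rfl⟩
    · exact fun hx => hx.2

/-- A covering design with any given positive number of blocks. -/
lemma isCoveringDesign_const_univ [Nonempty ι] :
    (ofSystem fun _ : X => (univ : Finset ι)).IsCoveringDesign := by
  simp [isCoveringDesign_ofSystem, univ_nonempty]

end

lemma bddBelow_limit (m : ℕ) :
    BddBelow {r : ℝ | ∃ (X : Type) (_ : Fintype X) (_ : Nonempty X) (D : MultiHypergraph X),
      D.IsCoveringDesign ∧ D.blocks.card = m ∧ r = D.limit} := by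
  refine ⟨0, ?_⟩
  rintro _ ⟨X, _, _, D, _, _, rfl⟩
  exact limit_nonneg D

lemma nonempty_limit {m : ℕ} (hm : 0 < m) :
    {r : ℝ | ∃ (X : Type) (_ : Fintype X) (_ : Nonempty X) (D : MultiHypergraph X),
      D.IsCoveringDesign ∧ D.blocks.card = m ∧ r = D.limit}.Nonempty := by
  have : Nonempty (Fin m) := ⟨⟨0, hm⟩⟩
  exact ⟨_, Unit, inferInstance, inferInstance, _,
    isCoveringDesign_const_univ (X := Unit) (ι := Fin m), by simp [card_blocks_ofSystem], rfl⟩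

/-- The infimum over all covering designs with `m` blocks is attained. -/
lemma exists_isFeasible_dataLimit {m : ℕ} (hm : 0 < m) :
    ∃ w, IsFeasible (id : Finset (Fin m) → Finset (Fin m)) w (dataLimit m) := by
  have : Nonempty (Fin m) := ⟨⟨0, hm⟩⟩
  -- Products of weights express "the support is pairwise intersecting" as a closed condition.
  set K : Set (Finset (Fin m) → ℝ) :=
    stdSimplex ℝ (Finset (Fin m)) ∩ {w | ∀ T U, T ∩ U = ∅ → w T * w U = 0} with hK
  have hKc : IsCompact K := by
    refine (isCompact_stdSimplex ℝ _).inter_right ?_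
    simp only [Set.ofPred_forall]
    refine isClosed_iInter fun T => isClosed_iInter fun U => isClosed_iInter fun _ => ?_
    exact isClosed_eq ((continuous_apply T).mul (continuous_apply U)) continuous_const
  have hKmem : ∀ {w v}, IsFeasible (id : Finset (Fin m) → Finset (Fin m)) w v → w ∈ K := by
    intro w v h
    refine ⟨⟨h.nonneg, h.sum_eq_one⟩, fun T U hTU => ?_⟩
    by_contra hne
    have := h.inter T U (left_ne_zero_of_mul hne) (right_ne_zero_of_mul hne)
    simp [hTU] at this
  -- Merging points with equal `S x` moves every design with `m` blocks to the one finite point set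
  -- `Finset (Fin m)`.
  have hlow : ∀ {X : Type} [Fintype X] [Nonempty X] (D : MultiHypergraph X), D.IsCoveringDesign →
      D.blocks.card = m →
      ∃ w, IsFeasible (id : Finset (Fin m) → Finset (Fin m)) w D.limit := by
    intro X _ _ D hD hcard
    obtain ⟨S, rfl⟩ := exists_eq_ofSystem D hcard
    obtain ⟨w, hw⟩ := exists_isFeasible_limit hD
    exact ⟨_, hw.map⟩
  obtain ⟨w₀, hw₀⟩ := hlow _ (isCoveringDesign_const_univ (X := Unit) (ι := Fin m))
    (by simp [card_blocks_ofSystem])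
  obtain ⟨w, hw, hmin⟩ := hKc.exists_isMinOn ⟨w₀, hKmem hw₀⟩
    (continuous_maxWeight_ofSystem (id : Finset (Fin m) → Finset (Fin m))).continuousOn
  refine ⟨w, hw.1.1, hw.1.2, fun T U hT hU => ?_, maxWeight_ofSystem_le_iff.1 ?_⟩
  · by_contra hne
    exact mul_ne_zero hT hU (hw.2 T U (Finset.not_nonempty_iff_eq_empty.1 hne))
  · refine le_csInf (nonempty_limit hm) ?_
    rintro _ ⟨X, _, _, D, hD, hcard, rfl⟩
    obtain ⟨w', hw'⟩ := hlow D hD hcard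
    exact (hmin (hKmem hw')).trans (maxWeight_ofSystem_le_iff.2 hw'.load_le)

/-! ### The two critical values and their equality cases -/

/-- A uniform covering design bounds `dataLimit` from above. -/
lemma dataLimit_le {X : Type} [Fintype X] {D : MultiHypergraph X} (hD : D.IsCoveringDesign)
    {k m n : ℕ} (hk : D.IsUniform k) (hn : Fintype.card X = n) (hn0 : 0 < n) (hm : D.blocks.card = m) :
    dataLimit m ≤ k / n := by
  have : Nonempty X := Fintype.card_pos_iff.1 (hn ▸ hn0)
  have hn0' : (n : ℝ) ≠ 0 := by exact_mod_cast hn0.ne'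
  refine (csInf_le (bddBelow_limit m) ⟨X, inferInstance, this, D, hD, hm, rfl⟩).trans ?_
  refine (csInf_le (bddBelow_maxWeight D)
    ⟨fun _ => 1 / n, ⟨fun _ => by positivity, by simp [hn, hn0']⟩, rfl⟩).trans ?_
  refine Real.sSup_le ?_ (by positivity)
  rintro _ ⟨B, hB, rfl⟩
  simp [hk B hB, div_eq_mul_inv]

/-- In the low-degree case `v ≥ 1 / s`, which is larger since `s * (s + 1) < s ^ 2 + s + 1`. -/
lemma projective_value_le {X ι : Type*} [Fintype X] [Fintype ι] [DecidableEq ι]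
    {S : X → Finset ι} {w : X → ℝ} {v : ℝ} (h : IsFeasible S w v) {s : ℕ} (hs : 1 ≤ s)
    (hι : Fintype.card ι = s ^ 2 + s + 1) : ((s : ℝ) + 1) / ((s : ℝ) ^ 2 + s + 1) ≤ v := by
  have : Nonempty ι := Fintype.card_pos_iff.1 (by omega)
  have hs' : (1 : ℝ) ≤ s := by exact_mod_cast hs
  rw [div_le_iff₀ (by positivity)]
  rcases h.value_ge s with h1 | h1
  · have hv := h.value_nonneg
    nlinarith
  · rw [hι] at h1
    push_cast at h1
    linarith

/-- Both alternatives of `value_ge` give the same bound, as `(s + 1) / (s ^ 2 + s) = 1 / s`. -/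
lemma affine_value_le {X ι : Type*} [Fintype X] [Fintype ι] [DecidableEq ι]
    {S : X → Finset ι} {w : X → ℝ} {v : ℝ} (h : IsFeasible S w v) {s : ℕ} (hs : 1 ≤ s)
    (hι : Fintype.card ι = s ^ 2 + s) : 1 / (s : ℝ) ≤ v := by
  have : Nonempty ι := Fintype.card_pos_iff.1 (by rw [hι]; positivity)
  have hs' : (1 : ℝ) ≤ s := by exact_mod_cast hs
  rw [div_le_iff₀ (by positivity)]
  rcases h.value_ge s with h1 | h1
  · linarith
  · rw [hι] at h1
    push_cast at h1
    nlinarith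

/-- A support point of degree at most `s` would give `1 ≤ s * (s + 1) / (s ^ 2 + s + 1)`. -/
lemma projective_tight {X ι : Type*} [Fintype X] [Fintype ι] [DecidableEq ι]
    {S : X → Finset ι} {w : X → ℝ} {s : ℕ}
    (h : IsFeasible S w (((s : ℝ) + 1) / ((s : ℝ) ^ 2 + s + 1))) (hs : 1 ≤ s)
    (hι : Fintype.card ι = s ^ 2 + s + 1) :
    (∀ x, w x ≠ 0 → (S x).card = s + 1) ∧
      ∀ i, load S w i = ((s : ℝ) + 1) / ((s : ℝ) ^ 2 + s + 1) := by
  have hs' : (1 : ℝ) ≤ s := by exact_mod_cast hs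
  refine h.tight (fun x hx => ?_) (by rw [hι]; push_cast; field_simp)
  by_contra! hlt
  have h1 := h.one_add_le hx
  have h2 : (1 : ℝ) ≤ (S x).card := by exact_mod_cast h.card_pos hx
  have h3 : ((S x).card : ℝ) ≤ s := by exact_mod_cast Nat.lt_succ_iff.1 hlt
  have h4 : 1 ≤ (S x).card * (((s : ℝ) + 1) / ((s : ℝ) ^ 2 + s + 1)) := by
    nlinarith [h.nonneg x]
  rw [mul_div_assoc', le_div_iff₀ (by positivity)] at h4
  nlinarith

/-- A degree at most `s` must equal `s`, and then `1 + (s - 1) * w x ≤ 1` contradicts `w x > 0`;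
this needs `2 ≤ s`. -/
lemma affine_tight {X ι : Type*} [Fintype X] [Fintype ι] [DecidableEq ι]
    {S : X → Finset ι} {w : X → ℝ} {s : ℕ} (h : IsFeasible S w (1 / s)) (hs : 2 ≤ s)
    (hι : Fintype.card ι = s ^ 2 + s) :
    (∀ x, w x ≠ 0 → (S x).card = s + 1) ∧ ∀ i, load S w i = 1 / s := by
  have hs' : (2 : ℝ) ≤ s := by exact_mod_cast hs
  refine h.tight (fun x hx => ?_) (by rw [hι]; push_cast; field_simp)
  by_contra! hlt
  have h1 := h.one_add_le hx
  have hpos : 0 < w x := lt_of_le_of_ne (h.nonneg x) hx.symm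
  have h2 : (1 : ℝ) ≤ (S x).card := by exact_mod_cast h.card_pos hx
  have h3 : ((S x).card : ℝ) ≤ s := by exact_mod_cast Nat.lt_succ_iff.1 hlt
  rw [mul_one_div, le_div_iff₀ (by linarith)] at h1
  have h4 : 0 ≤ ((S x).card - 1) * w x * s := by
    have : 0 ≤ ((S x).card - 1 : ℝ) := by linarith
    positivity
  have h5 : ((S x).card : ℝ) = s := by nlinarith
  rw [h5] at h1
  have h6 : 0 < (s - 1 : ℝ) * w x * s := by
    have : 0 < (s - 1 : ℝ) := by linarith
    positivity
  nlinarith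

section

variable {X ι : Type*} [Fintype X] [Fintype ι] [DecidableEq ι] {S : X → Finset ι} {s : ℕ}
  {w : X → ℝ}

/-- An optimal weighting on few points comes from a projective plane. -/
lemma isProjectivePlane_of_isFeasible (hS : (ofSystem S).IsCoveringDesign) (hs : 1 ≤ s)
    (hι : Fintype.card ι = s ^ 2 + s + 1) (hX : Fintype.card X ≤ s ^ 2 + s + 1)
    (h : IsFeasible S w (((s : ℝ) + 1) / ((s : ℝ) ^ 2 + s + 1))) :
    (ofSystem S).IsProjectivePlane s := by
  obtain ⟨hdeg, hload⟩ := projective_tight h hs hι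
  -- The choice of `q` fits because `(s + 1) ^ 2 = q + s`.
  obtain ⟨h1, h2, h3⟩ := h.flat (q := s ^ 2 + s + 1) hs (by positivity)
    (by push_cast; field_simp; ring) hdeg hload hX
  refine ⟨⟨hS, fun x y hxy => ?_⟩, isUniform_ofSystem.2 fun i => ?_, h1, ?_⟩
  · rw [pairDegree_ofSystem, h2 x y hxy]
  · have := h3 i
    push_cast at this
    rw [div_mul_cancel₀ _ (by positivity)] at this
    exact_mod_cast this
  · rw [card_blocks_ofSystem, hι]

/-- An optimal weighting on few points comes from an affine plane. -/
lemma isAffinePlane_of_isFeasible (hS : (ofSystem S).IsCoveringDesign) (hs : 2 ≤ s)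
    (hι : Fintype.card ι = s ^ 2 + s) (hX : Fintype.card X ≤ s ^ 2)
    (h : IsFeasible S w (1 / s)) : (ofSystem S).IsAffinePlane s := by
  obtain ⟨hdeg, hload⟩ := affine_tight h hs hι
  have hs0 : (s : ℝ) ≠ 0 := by positivity
  obtain ⟨h1, h2, h3⟩ := h.flat (q := s ^ 2) (by omega) (by positivity)
    (by push_cast; field_simp) hdeg hload hX
  refine ⟨⟨hS, fun x y hxy => ?_⟩, isUniform_ofSystem.2 fun i => ?_, h1, ?_⟩
  · rw [pairDegree_ofSystem, h2 x y hxy]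
  · have := h3 i
    push_cast at this
    rw [one_div, sq, inv_mul_cancel_left₀ hs0] at this
    exact_mod_cast this
  · rw [card_blocks_ofSystem, hι]

end

/-- Independent rows bound the support by the number of blocks, which is exactly the bound on points
needed for tightness. -/
lemma exists_isProjectivePlane {s : ℕ} (hs : 1 ≤ s)
    (h : dataLimit (s ^ 2 + s + 1) = ((s : ℝ) + 1) / ((s : ℝ) ^ 2 + s + 1)) :
    ∃ (X : Type) (_ : Fintype X) (D : MultiHypergraph X), D.IsProjectivePlane s := by
  classical
  obtain ⟨w₀, hw₀⟩ := exists_isFeasible_dataLimit (m := s ^ 2 + s + 1) (by positivity)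
  rw [h] at hw₀
  obtain ⟨w, hw, hind⟩ := hw₀.exists_linearIndependent (Nat.succ_ne_zero s)
    fun w' hw' => (projective_tight hw' hs (Fintype.card_fin _)).1
  refine ⟨{T // w T ≠ 0}, inferInstance, _, isProjectivePlane_of_isFeasible
    (isCoveringDesign_ofSystem.2 fun x y => hw.inter x y x.2 y.2) hs (Fintype.card_fin _) ?_
    hw.restrict⟩
  simpa using hind.fintype_card_le_finrank

lemma exists_isAffinePlane_or {s : ℕ} (hs : 2 ≤ s) (h : dataLimit (s ^ 2 + s) = 1 / (s : ℝ)) :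
    (∃ (X : Type) (_ : Fintype X) (D : MultiHypergraph X), D.IsAffinePlane s) ∨
      ∃ (X : Type) (_ : Fintype X) (D : MultiHypergraph X), D.IsAlmostProjectivePlane s := by
  classical
  obtain ⟨w₀, hw₀⟩ := exists_isFeasible_dataLimit (m := s ^ 2 + s) (by positivity)
  rw [h] at hw₀
  obtain ⟨w, hw, hind⟩ := hw₀.exists_linearIndependent (Nat.succ_ne_zero s)
    fun w' hw' => (affine_tight hw' hs (Fintype.card_fin _)).1
  have hr := hw.restrict
  have hcov : (ofSystem fun T : {T // w T ≠ 0} => (T : Finset (Fin (s ^ 2 + s)))).IsCoveringDesign :=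
    isCoveringDesign_ofSystem.2 fun x y => hw.inter x y x.2 y.2
  obtain ⟨hdeg, hload⟩ := affine_tight hr hs (Fintype.card_fin _)
  rcases le_or_gt (Fintype.card {T // w T ≠ 0}) (s ^ 2) with hX | hX
  · exact Or.inl ⟨_, inferInstance, _,
      isAffinePlane_of_isFeasible hcov hs (Fintype.card_fin _) hX hr⟩
  · obtain ⟨h1, h2⟩ := hr.card_block_of_lt (by omega) (fun x => x.2) (Fintype.card_fin _)
      (fun x => hdeg x x.2) hload hind hX
    refine Or.inr ⟨_, inferInstance, _, hcov, isUniform_ofSystem.2 h2, h1, ?_, fun x => ?_⟩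
    · rw [card_blocks_ofSystem, Fintype.card_fin]
    · rw [degree_ofSystem]
      exact hdeg x x.2

/-- A design on no points has limit zero. -/
lemma nonempty_of_limit_pos {X : Type*} [Fintype X] {D : MultiHypergraph X} (h : 0 < D.limit) :
    Nonempty X := by
  by_contra hX
  rw [not_nonempty_iff] at hX
  have : {r : ℝ | ∃ w : X → ℝ, MultiHypergraph.IsNormalisedWeighting w ∧ r = D.maxWeight w} = ∅ := by
    ext r
    simp [MultiHypergraph.IsNormalisedWeighting]
  rw [MultiHypergraph.limit, this, Real.sInf_empty] at h
  exact lt_irrefl _ h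

end ATAC


theorem theorem1p2 :
    (∀ s : ℕ, 1 ≤ s →
      (ATAC.dataLimit (s ^ 2 + s + 1) = ((s : ℝ) + 1) / ((s : ℝ) ^ 2 + s + 1) ↔
        ∃ (X : Type) (_ : Fintype X) (D : ATAC.MultiHypergraph X), D.IsProjectivePlane s) ∧
      (∀ (X : Type*) [Fintype X] (D : ATAC.MultiHypergraph X), D.IsCoveringDesign →
        D.blocks.card = s ^ 2 + s + 1 → Fintype.card X ≤ s ^ 2 + s + 1 →
        D.limit = ((s : ℝ) + 1) / ((s : ℝ) ^ 2 + s + 1) → D.IsProjectivePlane s)) ∧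
    (∀ s : ℕ, 2 ≤ s →
      (ATAC.dataLimit (s ^ 2 + s) = 1 / (s : ℝ) ↔
        (∃ (X : Type) (_ : Fintype X) (D : ATAC.MultiHypergraph X), D.IsAffinePlane s) ∨
        (∃ (X : Type) (_ : Fintype X) (D : ATAC.MultiHypergraph X), D.IsAlmostProjectivePlane s)) ∧
      (∀ (X : Type*) [Fintype X] (D : ATAC.MultiHypergraph X), D.IsCoveringDesign →
        D.blocks.card = s ^ 2 + s → Fintype.card X ≤ s ^ 2 →
        D.limit = 1 / (s : ℝ) → D.IsAffinePlane s)) := by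
  constructor
  · intro s hs
    have hval : (0 : ℝ) < ((s : ℝ) + 1) / ((s : ℝ) ^ 2 + s + 1) := by positivity
    refine ⟨⟨ATAC.exists_isProjectivePlane hs, ?_⟩, ?_⟩
    · rintro ⟨X, _, D, hD, hk, hX, hm⟩
      refine le_antisymm ?_ ?_
      · simpa using ATAC.dataLimit_le hD.1 hk hX (by positivity) hm
      · obtain ⟨w, hw⟩ := ATAC.exists_isFeasible_dataLimit (m := s ^ 2 + s + 1) (by positivity)
        exact ATAC.projective_value_le hw hs (Fintype.card_fin _)
    · intro X _ D hD hm hX hlim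
      have := ATAC.nonempty_of_limit_pos (hlim ▸ hval)
      obtain ⟨S, rfl⟩ := ATAC.exists_eq_ofSystem D hm
      obtain ⟨w, hw⟩ := ATAC.exists_isFeasible_limit hD
      exact ATAC.isProjectivePlane_of_isFeasible hD hs (Fintype.card_fin _) hX (hlim ▸ hw)
  · intro s hs
    have hs' : (0 : ℝ) < s := by positivity
    refine ⟨⟨ATAC.exists_isAffinePlane_or hs, fun h => le_antisymm ?_ ?_⟩, ?_⟩
    · rcases h with ⟨X, _, D, hD, hk, hX, hm⟩ | ⟨X, _, D, hD, hk, hX, hm, -⟩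
      · refine (ATAC.dataLimit_le hD.1 hk hX (by positivity) hm).trans (le_of_eq ?_)
        push_cast
        field_simp
      · refine (ATAC.dataLimit_le hD hk hX (by positivity) hm).trans (le_of_eq ?_)
        push_cast
        field_simp
    · obtain ⟨w, hw⟩ := ATAC.exists_isFeasible_dataLimit (m := s ^ 2 + s) (by positivity)
      exact ATAC.affine_value_le hw (by omega) (Fintype.card_fin _)
    · intro X _ D hD hm hX hlim
      have := ATAC.nonempty_of_limit_pos (D := D) (by rw [hlim]; positivity)
      obtain ⟨S, rfl⟩ := ATAC.exists_eq_ofSystem D hm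
      have : Nonempty (Fin (s ^ 2 + s)) := ⟨⟨0, by positivity⟩⟩
      obtain ⟨w, hw⟩ := ATAC.exists_isFeasible_limit hD
      exact ATAC.isAffinePlane_of_isFeasible hD hs (Fintype.card_fin _) hX (hlim ▸ hw)
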